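/- A transmitter with a battery of finite capacity $\bar B$ and initial level $b\in[0,\bar B]$ harvests energies $E_1,E_2,\dots$, which are i.i.d. random variables with values in an alphabet $\mathcal E\subseteq[0,\infty)$ (finite or not). An online policy of length $n$ is a sequence of (measurable) maps $g_t:\mathcal E^t\to[0,\infty)$, $t=1,\dots,n$; an offline policy of length $n$ is a sequence of (measurable) maps $g_t:\mathcal E^n\to[0,\infty)$, $t=1,\dots,n$. A policy is admissible if for every $e^n=(e_1,\dots,e_n)\in\mathcal E^n$ and every $t\le n$ one has $g_t\le b_t$, where the battery levels are given by $b_0=b$, $g_0=0$ and $b_t=\min\{b_{t-1}-g_{t-1}+e_t,\bar B\}$. The average throughput of a policy $g^n=(g_1,\dots,g_n)$ is $\mathscr T(g^n)=\frac1n\,\mathbb E\big[\sum_{t=1}^n\frac12\log_2(1+g_t)\big]$, where $g_t$ is evaluated at $(E_1,\dots,E_t)$ for an online policy and at $(E_1,\dots,E_n)$ for an offline policy. Let $T^{\mathrm{online}}$ (respectively $T^{\mathrm{offline}}$) be the limit inferior, as $n\to\infty$, of the supremum of $\mathscr T(g^n)$ over all admissible online (respectively offline) policies of length $n$. Let $\mu=\mathbb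 E[\min\{E_1,\bar B\}]$. Then $$\tfrac12\log_2(1+\mu)-1.80\;\le\;T^{\mathrm{online}}\;\le\;T^{\mathrm{offline}}\;\le\;\tfrac12\log_2(1+\mu).$$ Moreover, the lower bound is achieved by a single online policy: there is a sequence of maps $g_t:\mathcal E^t\to[0,\infty)$, $t=1,2,\dots$, whose first $n$ terms $g^n$ form an admissible online policy for every $n$, such that $\liminf_{n\to\infty}\mathscr T(g^n)\ge\frac12\log_2(1+\mu)-1.80$. -/

import Mathlib

open MeasureTheory ProbabilityTheory Filter

noncomputable section

namespace EnergyHarvesting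

/-- Battery level in the `(t+1)`-st of `n` time slots (slots are numbered from `0` here), for a
battery of capacity `Bmax` with initial level `b`, when the energies arriving in the slots are
`e 0, …, e (n-1)` and the energies spent in the slots are `p 0, …, p (n-1)`:
the new level is `min (old level - energy spent + energy arriving) Bmax`.
Nothing is spent before the first slot. -/
def battery (Bmax b : ℝ) {n : ℕ} (p e : Fin n → ℝ) : (t : ℕ) → t < n → ℝ
  | 0, h => min (b + e ⟨0, h⟩) Bmax
  | t + 1, h =>
      min (battery Bmax b p e t (Nat.lt_of_succ_lt h) - p ⟨t, Nat.lt_of_succ_lt h⟩ + e ⟨t + 1, h⟩)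
        Bmax

/-- An offline policy of length `n` over the alphabet `A` of energy arrivals: the power used in
each slot is a function of the whole arrival sequence. -/
abbrev OfflinePolicy (A : Set ℝ) (n : ℕ) : Type := (t : Fin n) → (Fin n → A) → ℝ

/-- An online policy of length `n`: the power used in a slot is a function of the arrivals up to
and including that slot. -/
abbrev OnlinePolicy (A : Set ℝ) (n : ℕ) : Type := (t : Fin n) → (Fin (t.val + 1) → A) → ℝ

/-- The first `t + 1` arrivals of a sequence of length `n`. -/
def history {A : Set ℝ} {n : ℕ} (t : Fin n) (e : Fin n → A) : Fin (t.val + 1) → A :=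
  fun i => e (Fin.castLE t.isLt i)

/-- An online policy regarded as an offline policy that does not look ahead. -/
def OnlinePolicy.toOffline {A : Set ℝ} {n : ℕ} (g : OnlinePolicy A n) : OfflinePolicy A n :=
  fun t e => g t (history t e)

/-- The energy constraints: along every arrival sequence, the power used in each slot is
nonnegative and at most the battery level in that slot. -/
def EnergyFeasible {A : Set ℝ} (Bmax b : ℝ) {n : ℕ} (g : OfflinePolicy A n) : Prop :=
  ∀ (e : Fin n → A) (t : Fin n),
    0 ≤ g t e ∧ g t e ≤ battery Bmax b (fun s => g s e) (fun s => (e s : ℝ)) t.val t.isLt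

/-- The admissible offline policies of length `n`. Measurability is automatic if the alphabet is
finite or countable. -/
def admissibleOffline (A : Set ℝ) (Bmax b : ℝ) (n : ℕ) : Set (OfflinePolicy A n) :=
  {g | (∀ t, Measurable (g t)) ∧ EnergyFeasible Bmax b g}

/-- The admissible online policies of length `n`. -/
def admissibleOnline (A : Set ℝ) (Bmax b : ℝ) (n : ℕ) : Set (OnlinePolicy A n) :=
  {g | (∀ t, Measurable (g t)) ∧ EnergyFeasible Bmax b g.toOffline}

/-- The average throughput of a policy of length `n` when `E 0, E 1, …` are the random energies
arriving in the successive slots. -/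
def throughput {A : Set ℝ} {Ω : Type*} [MeasurableSpace Ω] (P : Measure Ω) (E : ℕ → Ω → A)
    {n : ℕ} (g : OfflinePolicy A n) : ℝ :=
  (1 / (n : ℝ)) *
    ∫ ω, ∑ t : Fin n, (1 / 2) * Real.logb 2 (1 + g t (fun s : Fin n => E s.val ω)) ∂P

/-- The long-term average throughput of the online power control problem. -/
def onlineThroughput {A : Set ℝ} {Ω : Type*} [MeasurableSpace Ω] (P : Measure Ω)
    (E : ℕ → Ω → A) (Bmax b : ℝ) : ℝ :=
  liminf (fun n : ℕ => sSup ((fun g : OnlinePolicy A n => throughput P E g.toOffline) ''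
    admissibleOnline A Bmax b n)) atTop

/-- The long-term average throughput of the offline power control problem. -/
def offlineThroughput {A : Set ℝ} {Ω : Type*} [MeasurableSpace Ω] (P : Measure Ω)
    (E : ℕ → Ω → A) (Bmax b : ℝ) : ℝ :=
  liminf (fun n : ℕ => sSup ((fun g : OfflinePolicy A n => throughput P E g) ''
    admissibleOffline A Bmax b n)) atTop

/-- The first `n` slots of an online policy with infinite horizon. -/
def truncate {A : Set ℝ} (g : (t : ℕ) → (Fin (t + 1) → A) → ℝ) (n : ℕ) : OnlinePolicy A n :=
  fun t => g t.val

end EnergyHarvesting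

end

/-! Upper bound: along every path the energy spent is at most `b` plus the arrivals truncated at the
capacity, so the mean power per slot is at most `μ + b / n`; concavity of the logarithm bounds the
throughput by its value there (`throughput_le`), and `b / n` vanishes in the limit.

Lower bound: spend the fixed fraction `q = μ / Bmax` of the battery in every slot. An arrival `e`
is, for a concave reward, at least as good as a full recharge with probability `θ = min e Bmax /
Bmax` and nothing otherwise, and `θ` has mean `q`. A full battery earns `log (1 + q * Bmax) = log (1
+ μ)`. As the level is independent of the next arrival, the expected rewards satisfy `u (t + 1) ≥ (1
- q) * u t + q * (log (1 + μ) - 1)` (`integral_log_level_succ_ge`), and summing gives an average of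
at least `log (1 + μ) - 1 - O(1 / n)` nats before the factor `1 / 2`. -/

theorem integrable_of_mem_Icc {Ω : Type*} [MeasurableSpace Ω] {P : Measure Ω}
    [IsFiniteMeasure P] {f : Ω → ℝ} {a c : ℝ} (hf : Measurable f)
    (h : ∀ ω, f ω ∈ Set.Icc a c) : Integrable f P :=
  Integrable.of_mem_Icc a c hf.aemeasurable (ae_of_all _ h)

namespace EnergyHarvesting

/-! ### Pathwise energy conservation -/

section Pathwise

variable {A : Set ℝ} {Bmax b : ℝ} {n : ℕ}

theorem battery_le (p e : Fin n → ℝ) (t : ℕ) (ht : t < n) : battery Bmax b p e t ht ≤ Bmax := by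
  cases t <;> exact min_le_right _ _

/-- The energy spent so far plus the battery level is at most the initial level plus the
energies that arrived, each truncated at the capacity. -/
theorem sum_add_battery_le (hb : 0 ≤ b) {p e : Fin n → ℝ}
    (hp : ∀ t : Fin n, p t ≤ battery Bmax b p e t.val t.isLt) (t : ℕ) (ht : t < n) :
    ∑ s : Fin t, p (Fin.castLE ht.le s) + battery Bmax b p e t ht ≤
      b + ∑ s : Fin (t + 1), min (e (Fin.castLE ht s)) Bmax := by
  -- Truncating the sum loses at least as much as truncating the arrival alone; this needs the
  -- residual level `y` to be nonnegative, hence feasibility.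
  have key : ∀ y x : ℝ, 0 ≤ y → min (y + x) Bmax ≤ y + min x Bmax := by
    intro y x hy
    rw [← min_add_add_left]
    exact min_le_min le_rfl (by linarith)
  induction t with
  | zero =>
    have h := key b (e ⟨0, ht⟩) hb
    have e0 : Fin.castLE ht 0 = ⟨0, ht⟩ := rfl
    rw [Fin.sum_univ_zero, zero_add, battery, Fin.sum_univ_one, e0]
    exact h
  | succ t ih =>
    have h := ih (Nat.lt_of_succ_lt ht)
    have h1 := key (battery Bmax b p e t (Nat.lt_of_succ_lt ht) - p ⟨t, Nat.lt_of_succ_lt ht⟩)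
      (e ⟨t + 1, ht⟩) (sub_nonneg.2 (hp ⟨t, Nat.lt_of_succ_lt ht⟩))
    rw [Fin.sum_univ_castSucc, Fin.sum_univ_castSucc (n := t + 1), battery]
    simp only [Fin.castLE_castSucc] at h ⊢
    have e1 : Fin.castLE ht.le (Fin.last t) = ⟨t, Nat.lt_of_succ_lt ht⟩ := rfl
    have e2 : Fin.castLE ht (Fin.last (t + 1)) = ⟨t + 1, ht⟩ := rfl
    rw [e1, e2]
    linarith

theorem sum_le_of_le_battery (hb : 0 ≤ b) {p e : Fin n → ℝ}
    (hp : ∀ t : Fin n, p t ≤ battery Bmax b p e t.val t.isLt) :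
    ∑ t, p t ≤ b + ∑ t, min (e t) Bmax := by
  cases n with
  | zero => simpa using hb
  | succ n =>
    have h := sum_add_battery_le hb hp n n.lt_succ_self
    have h1 := hp (Fin.last n)
    rw [Fin.sum_univ_castSucc (f := p)]
    exact le_trans (add_le_add_right h1 _) h

theorem EnergyFeasible.le_capacity {g : OfflinePolicy A n} (hg : EnergyFeasible Bmax b g)
    (e : Fin n → A) (t : Fin n) : g t e ≤ Bmax :=
  (hg e t).2.trans (battery_le _ _ _ _)

theorem measurable_history (t : Fin n) : Measurable (history (A := A) t) :=
  measurable_pi_lambda _ fun _ => measurable_pi_apply _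

theorem toOffline_mem {g : OnlinePolicy A n} (hg : g ∈ admissibleOnline A Bmax b n) :
    g.toOffline ∈ admissibleOffline A Bmax b n :=
  ⟨fun t => (hg.1 t).comp (measurable_history t), hg.2⟩

end Pathwise

/-! ### Upper bound by concavity -/

section Upper

variable {Ω : Type*} [MeasurableSpace Ω] {P : Measure Ω} {A : Set ℝ} {E : ℕ → Ω → A}
  {Bmax b μ : ℝ} {n : ℕ}

theorem measurable_arrivals (hE : ∀ t, Measurable (E t)) (n : ℕ) :
    Measurable fun ω => fun s : Fin n => E s.val ω :=
  measurable_pi_lambda _ fun _ => hE _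

theorem integrable_min [IsProbabilityMeasure P] (hA : ∀ x ∈ A, 0 ≤ x)
    (hE : ∀ t, Measurable (E t)) (hB : 0 ≤ Bmax) (t : ℕ) : Integrable (fun ω => min (E t ω : ℝ) Bmax) P :=
  integrable_of_mem_Icc (a := 0) (c := Bmax)
    (((measurable_subtype_coe.comp (hE t))).min measurable_const)
    fun ω => ⟨le_min (hA _ (E t ω).2) hB, min_le_right _ _⟩

theorem integral_min (hident : ∀ t, IdentDistrib (E t) (E 0) P P)
    (hμ : μ = ∫ ω, min (E 0 ω : ℝ) Bmax ∂P) (t : ℕ) : ∫ ω, min (E t ω : ℝ) Bmax ∂P = μ := by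
  rw [hμ]
  exact ((hident t).comp (u := fun x : A => min (x : ℝ) Bmax)
    (measurable_subtype_coe.min measurable_const)).integral_eq

theorem log_le_tangent {a x : ℝ} (ha : 0 < 1 + a) (hx : 0 < 1 + x) :
    Real.log (1 + x) ≤ Real.log (1 + a) + (x - a) / (1 + a) := by
  have h := Real.log_le_sub_one_of_pos (div_pos hx ha)
  rw [Real.log_div hx.ne' ha.ne'] at h
  have : (1 + x) / (1 + a) - 1 = (x - a) / (1 + a) := by field_simp; ring
  linarith

theorem half_logb (x : ℝ) : 1 / 2 * Real.logb 2 x = Real.log x / (2 * Real.log 2) := by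
  rw [Real.logb]; field_simp

/-- The throughput of a policy in terms of natural logarithms. -/
theorem throughput_eq (g : OfflinePolicy A n) :
    throughput P E g = (1 / (n : ℝ)) *
      (∫ ω, ∑ t : Fin n, Real.log (1 + g t (fun s : Fin n => E s.val ω)) ∂P) /
        (2 * Real.log 2) := by
  rw [throughput, mul_div_assoc, ← integral_div]
  simp only [half_logb, Finset.sum_div]

theorem two_log_two_pos : 0 < 2 * Real.log 2 := by
  have := Real.log_pos one_lt_two
  linarith

theorem integrable_policy [IsProbabilityMeasure P] (hE : ∀ t, Measurable (E t))
    {g : OfflinePolicy A n}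
    (hg : g ∈ admissibleOffline A Bmax b n) (t : Fin n) :
    Integrable (fun ω => g t (fun s : Fin n => E s.val ω)) P :=
  integrable_of_mem_Icc ((hg.1 t).comp (measurable_arrivals hE n))
    fun _ => ⟨(hg.2 _ t).1, hg.2.le_capacity _ t⟩

theorem integrable_log_policy [IsProbabilityMeasure P] (hE : ∀ t, Measurable (E t))
    {g : OfflinePolicy A n}
    (hg : g ∈ admissibleOffline A Bmax b n) (t : Fin n) :
    Integrable (fun ω => Real.log (1 + g t (fun s : Fin n => E s.val ω))) P :=
  integrable_of_mem_Icc (a := 0) (c := Real.log (1 + Bmax))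
    (Real.measurable_log.comp (measurable_const.add
      ((hg.1 t).comp (measurable_arrivals hE n))))
    fun ω => by
      have h0 := (hg.2 (fun s : Fin n => E s.val ω) t).1
      have h1 := hg.2.le_capacity (fun s : Fin n => E s.val ω) t
      exact ⟨Real.log_nonneg (by linarith), Real.log_le_log (by linarith) (by linarith)⟩

theorem throughput_nonneg {g : OfflinePolicy A n} (hg : EnergyFeasible Bmax b g) :
    0 ≤ throughput P E g := by
  refine mul_nonneg (by positivity) (integral_nonneg fun ω => Finset.sum_nonneg fun t _ => ?_)
  have h0 := (hg (fun s : Fin n => E s.val ω) t).1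
  exact mul_nonneg (by norm_num) (Real.logb_nonneg one_lt_two (by linarith))

/-- Jensen's inequality over slots and randomness at once, in the form of a single tangent line to
the logarithm. -/
theorem throughput_le [IsProbabilityMeasure P] (hA : ∀ x ∈ A, 0 ≤ x) (hE : ∀ t, Measurable (E t))
    (hident : ∀ t, IdentDistrib (E t) (E 0) P P) (hb : 0 ≤ b) (hbB : b ≤ Bmax)
    (hμ : μ = ∫ ω, min (E 0 ω : ℝ) Bmax ∂P) (hμ0 : 0 ≤ μ) {g : OfflinePolicy A n}
    (hg : g ∈ admissibleOffline A Bmax b n) :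
    throughput P E g ≤ 1 / 2 * Real.logb 2 (1 + (μ + b / n)) := by
  rcases Nat.eq_zero_or_pos n with rfl | hn
  · simpa [throughput] using Real.logb_nonneg one_lt_two (by linarith : (1 : ℝ) ≤ 1 + μ)
  have hn' : (0 : ℝ) < n := Nat.cast_pos.2 hn
  -- Tangent at the bound for the mean power: the linear terms then sum to something nonpositive.
  set a := μ + b / n with ha
  have ha0 : 0 < 1 + a := by positivity
  rw [throughput_eq, half_logb]
  refine div_le_div_of_nonneg_right ?_ two_log_two_pos.le
  rw [one_div, inv_mul_le_iff₀ hn', integral_finsetSum _ fun t _ => integrable_log_policy hE hg t]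
  have h1 : ∀ t : Fin n, ∫ ω, Real.log (1 + g t (fun s : Fin n => E s.val ω)) ∂P ≤
      Real.log (1 + a) + ((∫ ω, g t (fun s : Fin n => E s.val ω) ∂P) - a) / (1 + a) := by
    intro t
    have hi := integrable_policy (P := P) hE hg t
    calc _ ≤ ∫ ω, (Real.log (1 + a) + (g t (fun s : Fin n => E s.val ω) - a) / (1 + a)) ∂P := by
          refine integral_mono (integrable_log_policy hE hg t) ?_ fun ω => ?_
          · exact (integrable_const _).add ((hi.sub (integrable_const _)).div_const _)
          · refine log_le_tangent ha0 ?_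
            have := (hg.2 (fun s : Fin n => E s.val ω) t).1
            linarith
      _ = _ := by
          have hs : Integrable (fun ω => (g t (fun s : Fin n => E s.val ω) - a) / (1 + a)) P :=
            (hi.sub (integrable_const a)).div_const _
          rw [integral_add (integrable_const _) hs, integral_div,
            integral_sub hi (integrable_const _)]
          simp
  have h2 : ∑ t : Fin n, ∫ ω, g t (fun s : Fin n => E s.val ω) ∂P ≤ n * a := by
    rw [← integral_finsetSum _ fun t _ => integrable_policy hE hg t]
    have hm : ∀ t : Fin n, Integrable (fun ω => min (E t.val ω : ℝ) Bmax) P :=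
      fun t => integrable_min hA hE (hb.trans hbB) t.val
    calc _ ≤ ∫ ω, (b + ∑ t : Fin n, min (E t.val ω : ℝ) Bmax) ∂P := by
          refine integral_mono (integrable_finsetSum _ fun t _ => integrable_policy hE hg t)
            ((integrable_const _).add (integrable_finsetSum _ fun t _ => hm t)) fun ω => ?_
          exact sum_le_of_le_battery hb fun t => (hg.2 (fun s : Fin n => E s.val ω) t).2
      _ = n * a := by
          rw [integral_add (integrable_const _) (integrable_finsetSum _ fun t _ => hm t),
            integral_finsetSum _ fun t _ => hm t]
          simp only [integral_min hident hμ]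
          simp [ha]
          field_simp
          ring
  refine (Finset.sum_le_sum fun t _ => h1 t).trans ?_
  rw [Finset.sum_add_distrib, ← Finset.sum_div, Finset.sum_sub_distrib]
  simp only [Finset.sum_const, Finset.card_univ, Fintype.card_fin, nsmul_eq_mul]
  have := div_nonpos_of_nonpos_of_nonneg (sub_nonpos.2 h2) ha0.le
  linarith

theorem tendsto_upper (hμ0 : 0 ≤ μ) :
    Tendsto (fun n : ℕ => 1 / 2 * Real.logb 2 (1 + (μ + b / n))) atTop
      (nhds (1 / 2 * Real.logb 2 (1 + μ))) := by
  have h : Tendsto (fun n : ℕ => 1 + (μ + b / n)) atTop (nhds (1 + (μ + 0))) :=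
    (tendsto_const_div_atTop_nhds_zero_nat b).const_add μ |>.const_add 1
  rw [add_zero] at h
  exact (h.logb (by positivity)).const_mul _

end Upper

/-! ### The fixed fraction policy -/

section Fraction

/-- The battery level in each slot when a fixed fraction `q` of it is spent in every slot. -/
def fractionLevel (q Bmax b : ℝ) (x : ℕ → ℝ) : ℕ → ℝ
  | 0 => min (b + x 0) Bmax
  | t + 1 => min ((1 - q) * fractionLevel q Bmax b x t + x (t + 1)) Bmax

variable {q Bmax b : ℝ}

theorem fractionLevel_le (x : ℕ → ℝ) (t : ℕ) : fractionLevel q Bmax b x t ≤ Bmax := by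
  cases t <;> exact min_le_right _ _

theorem fractionLevel_nonneg (hq : q ≤ 1) (hb : 0 ≤ b) (hB : 0 ≤ Bmax) {x : ℕ → ℝ}
    (hx : ∀ i, 0 ≤ x i) (t : ℕ) : 0 ≤ fractionLevel q Bmax b x t := by
  induction t with
  | zero => exact le_min (add_nonneg hb (hx 0)) hB
  | succ t ih =>
    exact le_min (add_nonneg (mul_nonneg (sub_nonneg.2 hq) ih) (hx _)) hB

theorem fractionLevel_congr {x y : ℕ → ℝ} {t : ℕ} (h : ∀ i ≤ t, x i = y i) :
    fractionLevel q Bmax b x t = fractionLevel q Bmax b y t := by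
  induction t with
  | zero => simp [fractionLevel, h 0 le_rfl]
  | succ t ih =>
    simp only [fractionLevel]
    rw [ih fun i hi => h i (hi.trans t.le_succ), h (t + 1) le_rfl]

theorem measurable_fractionLevel (t : ℕ) : Measurable fun x => fractionLevel q Bmax b x t := by
  induction t with
  | zero =>
    have h : Measurable fun x : ℕ → ℝ => x 0 := measurable_pi_apply 0
    exact (h.const_add b).min measurable_const
  | succ t ih =>
    exact ((ih.const_mul (1 - q)).add (measurable_pi_apply (t + 1))).min measurable_const

/-- Extend a finite arrival sequence by zeros. -/
def extendZero {A : Set ℝ} {n : ℕ} (e : Fin n → A) (i : ℕ) : ℝ :=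
  if h : i < n then (e ⟨i, h⟩ : ℝ) else 0

theorem measurable_extendZero {A : Set ℝ} {n : ℕ} :
    Measurable (extendZero : (Fin n → A) → ℕ → ℝ) := by
  refine measurable_pi_lambda _ fun i => ?_
  unfold extendZero
  split_ifs with h
  · exact measurable_subtype_coe.comp (measurable_pi_apply _)
  · exact measurable_const

/-- The online policy that spends the fraction `q` of the battery level in every slot. -/
def fractionPolicy (A : Set ℝ) (q Bmax b : ℝ) (t : ℕ) (e : Fin (t + 1) → A) : ℝ :=
  q * fractionLevel q Bmax b (extendZero e) t

theorem measurable_fractionPolicy (A : Set ℝ) (t : ℕ) :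
    Measurable (fractionPolicy A q Bmax b t) :=
  ((measurable_fractionLevel t).comp measurable_extendZero).const_mul q

theorem fractionPolicy_toOffline {A : Set ℝ} {n : ℕ} (t : Fin n) (e : Fin n → A) {x : ℕ → ℝ}
    (hx : ∀ i : Fin n, x i = e i) :
    (truncate (fractionPolicy A q Bmax b) n).toOffline t e =
      q * fractionLevel q Bmax b x t := by
  simp only [OnlinePolicy.toOffline, truncate, fractionPolicy]
  congr 1
  refine fractionLevel_congr fun i hi => ?_
  have hi' : i < t.val + 1 := Nat.lt_succ_of_le hi
  rw [extendZero, dif_pos hi', history]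
  exact (hx ⟨i, hi'.trans_le t.isLt⟩).symm

theorem battery_fractionPolicy {n : ℕ} {p e : Fin n → ℝ} {x : ℕ → ℝ}
    (hx : ∀ i : Fin n, x i = e i) (hp : ∀ i : Fin n, p i = q * fractionLevel q Bmax b x i)
    (t : ℕ) (ht : t < n) : battery Bmax b p e t ht = fractionLevel q Bmax b x t := by
  induction t with
  | zero => rw [battery, fractionLevel, ← hx]
  | succ t ih =>
    rw [battery, fractionLevel, ih, hp, ← hx]
    congr 2
    ring

theorem truncate_fractionPolicy_mem {A : Set ℝ} (hA : ∀ x ∈ A, 0 ≤ x) (hq0 : 0 ≤ q)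
    (hq : q ≤ 1) (hb : 0 ≤ b) (hB : 0 ≤ Bmax) (n : ℕ) :
    truncate (fractionPolicy A q Bmax b) n ∈ admissibleOnline A Bmax b n := by
  refine ⟨fun t => measurable_fractionPolicy A t, fun e t => ?_⟩
  have hx : ∀ i : Fin n, extendZero e i = e i := fun i => by simp [extendZero]
  have hn : 0 ≤ fractionLevel q Bmax b (extendZero e) t := by
    refine fractionLevel_nonneg hq hb hB (fun i => ?_) t
    unfold extendZero
    split_ifs
    · exact hA _ (e _).2
    · exact le_rfl
  rw [battery_fractionPolicy hx fun i => fractionPolicy_toOffline i e hx,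
    fractionPolicy_toOffline t e hx]
  exact ⟨mul_nonneg hq0 hn, mul_le_of_le_one_left hn hq⟩

/-- Concavity of the logarithm bounds the reward after an arrival `e` from below by the
interpolation between no arrival and a full recharge. -/
theorem log_recharge_ge {y e : ℝ} (hq0 : 0 ≤ q) (hB : 0 < Bmax) (hy0 : 0 ≤ y) (hy : y ≤ Bmax)
    (he : 0 ≤ e) :
    (1 - min e Bmax / Bmax) * Real.log (1 + q * y) +
      min e Bmax / Bmax * Real.log (1 + q * Bmax) ≤ Real.log (1 + q * min (y + e) Bmax) := by
  set θ := min e Bmax / Bmax with hθ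
  have hθ0 : 0 ≤ θ := div_nonneg (le_min he hB.le) hB.le
  have hθ1 : θ ≤ 1 := (div_le_one hB).2 (min_le_right _ _)
  have hθB : θ * Bmax = min e Bmax := div_mul_cancel₀ _ hB.ne'
  have hqy : 0 ≤ q * y := mul_nonneg hq0 hy0
  have hqB : 0 ≤ q * Bmax := mul_nonneg hq0 hB.le
  have h := strictConcaveOn_log_Ioi.concaveOn.2 (x := 1 + q * y) (y := 1 + q * Bmax)
    (Set.mem_Ioi.2 (by linarith)) (Set.mem_Ioi.2 (by linarith)) (sub_nonneg.2 hθ1) hθ0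
    (by ring)
  simp only [smul_eq_mul] at h
  refine h.trans (Real.log_le_log ?_ ?_)
  · have h1 := mul_nonneg (sub_nonneg.2 hθ1) hqy
    have h2 := mul_nonneg hθ0 hqB
    linarith
  · have h3 : (1 - θ) * y + θ * Bmax ≤ min (y + e) Bmax := by
      refine le_min ?_ ?_
      · have := min_le_left e Bmax
        have := mul_nonneg hθ0 hy0
        linarith
      · have := mul_le_mul_of_nonneg_left hy (sub_nonneg.2 hθ1)
        linarith
    have := mul_le_mul_of_nonneg_left h3 hq0
    linarith

/-- Spending the fraction `q` of the battery level costs little in the reward. -/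
theorem log_discharge_ge {x : ℝ} (hq0 : 0 ≤ q) (hq : q ≤ 1) (hx : 0 ≤ x) :
    (1 - q) * Real.log (1 + q * x) - q ≤ (1 - q) * Real.log (1 + q * ((1 - q) * x)) := by
  have hp : 0 ≤ 1 - q := sub_nonneg.2 hq
  have hc : 0 < 1 + q * ((1 - q) * x) := by positivity
  have h := log_le_tangent hc (x := q * x) (by positivity)
  have h1 := mul_le_mul_of_nonneg_left h hp
  -- The weight `1 - q` is what makes the loss uniform in `x`: the quotient has the form `q * (c /
  -- (1 + c))` with `c = q * (1 - q) * x`.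
  have h2 : (1 - q) * ((q * x - q * ((1 - q) * x)) / (1 + q * ((1 - q) * x))) ≤ q := by
    rw [← mul_div_assoc, div_le_iff₀ hc]
    nlinarith
  linarith

end Fraction

/-! ### Lower bound by a recursion for the expected reward -/

section Lower

variable {Ω : Type*} [MeasurableSpace Ω] {P : Measure Ω} {A : Set ℝ} {E : ℕ → Ω → A}
  {q Bmax b μ : ℝ}

theorem measurable_level (hE : ∀ t, Measurable (E t)) (t : ℕ) :
    Measurable fun ω => fractionLevel q Bmax b (fun i => E i ω) t :=
  (measurable_fractionLevel t).comp
    (measurable_pi_lambda _ fun i => measurable_subtype_coe.comp (hE i))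

/-- The level in slot `t` is a measurable function of the arrivals up to slot `t` only. -/
theorem indepFun_level (hE : ∀ t, Measurable (E t)) (hindep : iIndepFun E P) (t : ℕ) :
    IndepFun (fun ω => fractionLevel q Bmax b (fun i => E i ω) t) (E (t + 1)) P := by
  have h := hindep.indepFun_finset (Finset.range (t + 1)) {t + 1} (by simp) hE
  have hφ : Measurable fun e : Finset.range (t + 1) → A =>
      fractionLevel q Bmax b (extendZero fun i : Fin (t + 1) =>
        e ⟨i.val, Finset.mem_range.2 i.isLt⟩) t :=
    ((measurable_fractionLevel t).comp measurable_extendZero).comp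
      (measurable_pi_lambda _ fun i => measurable_pi_apply _)
  have h' := h.comp hφ
    (measurable_pi_apply (⟨t + 1, Finset.mem_singleton_self _⟩ : ({t + 1} : Finset ℕ)))
  refine h'.congr (ae_of_all _ fun ω => ?_) (ae_of_all _ fun _ => rfl)
  refine fractionLevel_congr fun i hi => ?_
  simp [extendZero, Nat.lt_succ_of_le hi]

variable [IsProbabilityMeasure P]

theorem integrable_log_level (hE : ∀ t, Measurable (E t)) (hA : ∀ x ∈ A, 0 ≤ x) {c : ℝ}
    (hc : 0 ≤ c) (hq : q ≤ 1) (hb : 0 ≤ b) (hB : 0 ≤ Bmax) (t : ℕ) :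
    Integrable (fun ω => Real.log (1 + c * fractionLevel q Bmax b (fun i => E i ω) t)) P := by
  refine integrable_of_mem_Icc (a := 0) (c := Real.log (1 + c * Bmax))
    (Real.measurable_log.comp (((measurable_level hE t).const_mul c).const_add 1)) fun ω => ?_
  have h0 := mul_nonneg hc
    (fractionLevel_nonneg hq hb hB (fun i => hA _ (E i ω).2) t)
  have h1 := mul_le_mul_of_nonneg_left
    (fractionLevel_le (q := q) (Bmax := Bmax) (b := b) (fun i => (E i ω : ℝ)) t) hc
  exact ⟨Real.log_nonneg (by linarith), Real.log_le_log (by linarith) (by linarith)⟩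

/-- Take expectations in `log_recharge_ge` at `y = (1 - q) * Z`; independence factors the product,
and `log_discharge_ge` then replaces the depleted level by `Z` at cost `q`. -/
theorem integral_log_level_succ_ge (hA : ∀ x ∈ A, 0 ≤ x) (hE : ∀ t, Measurable (E t))
    (hindep : iIndepFun E P) (hident : ∀ t, IdentDistrib (E t) (E 0) P P) (hb : 0 ≤ b)
    (hB : 0 < Bmax) (hμ : μ = ∫ ω, min (E 0 ω : ℝ) Bmax ∂P) (hqB : q * Bmax = μ)
    (hq0 : 0 ≤ q) (hq : q ≤ 1) (t : ℕ) :
    (1 - q) * ∫ ω, Real.log (1 + q * fractionLevel q Bmax b (fun i => E i ω) t) ∂P +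
        q * (Real.log (1 + μ) - 1) ≤
      ∫ ω, Real.log (1 + q * fractionLevel q Bmax b (fun i => E i ω) (t + 1)) ∂P := by
  set Z : Ω → ℝ := fun ω => fractionLevel q Bmax b (fun i => E i ω) t with hZ
  set θ : Ω → ℝ := fun ω => min (E (t + 1) ω : ℝ) Bmax / Bmax with hθ
  set Y : Ω → ℝ := fun ω => Real.log (1 + q * ((1 - q) * Z ω)) with hY
  have hp : 0 ≤ 1 - q := sub_nonneg.2 hq
  have hZ0 : ∀ ω, 0 ≤ Z ω := fun ω =>
    fractionLevel_nonneg hq hb hB.le (fun i => hA _ (E i ω).2) t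
  have hZB : ∀ ω, Z ω ≤ Bmax := fun ω => fractionLevel_le _ t
  have hθi : Integrable θ P := (integrable_min hA hE hB.le (t + 1)).div_const _
  have hθm : ∫ ω, θ ω ∂P = q := by
    rw [integral_div, integral_min hident hμ, ← hqB, mul_div_cancel_right₀ _ hB.ne']
  have hYi : Integrable Y P := by
    have := integrable_log_level (P := P) hE hA (mul_nonneg hq0 hp) hq hb hB.le (q := q) t
    simpa only [hY, hZ, mul_assoc] using this
  have hind : IndepFun (fun ω => 1 - θ ω) Y P := by
    have h := (indepFun_level (q := q) (Bmax := Bmax) (b := b) hE hindep t).symm.comp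
      (φ := fun x : A => 1 - min (x : ℝ) Bmax / Bmax)
      (ψ := fun z : ℝ => Real.log (1 + q * ((1 - q) * z)))
      (((measurable_subtype_coe.min measurable_const).div_const _).const_sub 1)
      (by fun_prop)
    exact h
  have h1θ : Integrable (fun ω => 1 - θ ω) P := (integrable_const _).sub hθi
  have hprod : Integrable (fun ω => (1 - θ ω) * Y ω) P := hind.integrable_mul h1θ hYi
  have hEprod : ∫ ω, (1 - θ ω) * Y ω ∂P = (1 - q) * ∫ ω, Y ω ∂P := by
    rw [hind.integral_fun_mul_eq_mul_integral h1θ.1 hYi.1,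
      integral_sub (integrable_const _) hθi, hθm]
    simp
  have hdis : (1 - q) * ∫ ω, Real.log (1 + q * Z ω) ∂P - q ≤ (1 - q) * ∫ ω, Y ω ∂P := by
    have hi := integrable_log_level (P := P) hE hA hq0 hq hb hB.le (q := q) t
    have h := integral_mono (μ := P) ((hi.const_mul (1 - q)).sub (integrable_const q))
      (hYi.const_mul (1 - q)) fun ω => log_discharge_ge hq0 hq (hZ0 ω)
    simp only [Pi.sub_apply] at h
    rw [integral_sub (hi.const_mul (1 - q)) (integrable_const q), integral_const_mul,
      integral_const_mul] at h
    simpa using h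
  calc _ ≤ (1 - q) * ∫ ω, Y ω ∂P + q * Real.log (1 + μ) := by linarith
    _ = ∫ ω, ((1 - θ ω) * Y ω + θ ω * Real.log (1 + q * Bmax)) ∂P := by
        rw [integral_add hprod (hθi.mul_const _), integral_mul_const, hEprod, hθm, hqB]
    _ ≤ _ := by
        refine integral_mono (hprod.add (hθi.mul_const _))
          (integrable_log_level hE hA hq0 hq hb hB.le _) fun ω => ?_
        refine log_recharge_ge hq0 hB (mul_nonneg hp (hZ0 ω)) ?_ (hA _ (E (t + 1) ω).2)
        exact (mul_le_of_le_one_left (hZ0 ω) (by linarith)).trans (hZB ω)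

theorem throughput_fractionPolicy_ge (hA : ∀ x ∈ A, 0 ≤ x) (hE : ∀ t, Measurable (E t))
    (hindep : iIndepFun E P) (hident : ∀ t, IdentDistrib (E t) (E 0) P P) (hb : 0 ≤ b)
    (hB : 0 < Bmax) (hμ : μ = ∫ ω, min (E 0 ω : ℝ) Bmax ∂P) (hqB : q * Bmax = μ)
    (hq0 : 0 < q) (hq : q ≤ 1) {n : ℕ} (hn : 0 < n) :
    (Real.log (1 + μ) - 1 - Real.log (1 + μ) / q / n) / (2 * Real.log 2) ≤
      throughput P E (truncate (fractionPolicy A q Bmax b) n).toOffline := by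
  have hn' : (0 : ℝ) < n := Nat.cast_pos.2 hn
  set L := Real.log (1 + μ) with hL
  set u : ℕ → ℝ := fun t =>
    ∫ ω, Real.log (1 + q * fractionLevel q Bmax b (fun i => E i ω) t) ∂P with hu
  have hrec : ∀ t, (1 - q) * u t + q * (L - 1) ≤ u (t + 1) := fun t =>
    integral_log_level_succ_ge hA hE hindep hident hb hB hμ hqB hq0.le hq t
  have hu0 : ∀ t, 0 ≤ u t := fun t => integral_nonneg fun ω => Real.log_nonneg (by
    have := mul_nonneg hq0.le
      (fractionLevel_nonneg hq hb hB.le (fun i => hA _ (E i ω).2) t)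
    linarith)
  have huL : ∀ t, u t ≤ L := fun t => by
    have h := integral_mono (μ := P)
      (integrable_log_level hE hA hq0.le hq hb hB.le (q := q) t) (integrable_const L)
      fun ω => by
        have h0 := mul_nonneg hq0.le
          (fractionLevel_nonneg hq hb hB.le (fun i => hA _ (E i ω).2) t)
        have h1 := mul_le_mul_of_nonneg_left
          (fractionLevel_le (q := q) (Bmax := Bmax) (b := b) (fun i => (E i ω : ℝ)) t) hq0.le
        rw [hqB] at h1
        exact Real.log_le_log (by linarith) (by linarith)
    simpa using h
  -- The recursion reads `q * u t ≥ q * (L - 1) + u t - u (t + 1)`, which telescopes.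
  have hsum : ∀ m : ℕ, m * (q * (L - 1)) + u 0 - u m ≤ q * ∑ t ∈ Finset.range m, u t := by
    intro m
    induction m with
    | zero => simp
    | succ m ih =>
      rw [Finset.sum_range_succ]
      push_cast
      linarith [hrec m]
  rw [throughput_eq]
  refine div_le_div_of_nonneg_right ?_ two_log_two_pos.le
  have hT : ∫ ω, ∑ t : Fin n, Real.log (1 + (truncate (fractionPolicy A q Bmax b) n).toOffline t
      (fun s : Fin n => E s.val ω)) ∂P = ∑ t ∈ Finset.range n, u t := by
    have he : ∀ ω (t : Fin n), (truncate (fractionPolicy A q Bmax b) n).toOffline t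
        (fun s : Fin n => E s.val ω) = q * fractionLevel q Bmax b (fun i => E i ω) t :=
      fun ω t => fractionPolicy_toOffline t _ fun _ => rfl
    simp only [he]
    rw [integral_finsetSum _ fun t _ => integrable_log_level hE hA hq0.le hq hb hB.le _,
      Finset.sum_range]
  rw [hT, one_div, ← div_eq_inv_mul, le_div_iff₀ hn']
  have h := hsum n
  have h1 := hu0 0
  have h2 := huL n
  rw [← mul_le_mul_iff_right₀ hq0]
  have h3 : q * ((L - 1 - L / q / n) * n) = n * (q * (L - 1)) - L := by
    field_simp
  linarith

end Lower

end EnergyHarvesting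

open EnergyHarvesting in
theorem theorem3 {Ω : Type*} [MeasurableSpace Ω] (P : Measure Ω) [IsProbabilityMeasure P]
    (A : Set ℝ) (hA : ∀ x ∈ A, 0 ≤ x)
    (E : ℕ → Ω → A) (hE : ∀ t, Measurable (E t))
    (hindep : iIndepFun E P) (hident : ∀ t, IdentDistrib (E t) (E 0) P P)
    (Bmax b : ℝ) (hb : 0 ≤ b) (hbB : b ≤ Bmax)
    (μ : ℝ) (hμ : μ = ∫ ω, min (E 0 ω : ℝ) Bmax ∂P) :
    (1 / 2 * Real.logb 2 (1 + μ) - 1.80 ≤ EnergyHarvesting.onlineThroughput P E Bmax b ∧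
      EnergyHarvesting.onlineThroughput P E Bmax b ≤
        EnergyHarvesting.offlineThroughput P E Bmax b ∧
      EnergyHarvesting.offlineThroughput P E Bmax b ≤ 1 / 2 * Real.logb 2 (1 + μ)) ∧
    ∃ g : (t : ℕ) → (Fin (t + 1) → A) → ℝ,
      (∀ n, EnergyHarvesting.truncate g n ∈ EnergyHarvesting.admissibleOnline A Bmax b n) ∧
      1 / 2 * Real.logb 2 (1 + μ) - 1.80 ≤
        liminf (fun n : ℕ =>
          EnergyHarvesting.throughput P E (EnergyHarvesting.truncate g n).toOffline) atTop := by
  have hB : 0 ≤ Bmax := hb.trans hbB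
  have hμ0 : 0 ≤ μ := hμ ▸ integral_nonneg fun ω => le_min (hA _ (E 0 ω).2) hB
  have hμB : μ ≤ Bmax := by
    have h := integral_mono (integrable_min (P := P) hA hE hB 0) (integrable_const Bmax)
      fun ω => min_le_right _ _
    simpa [hμ] using h
  set U : ℕ → ℝ := fun n => 1 / 2 * Real.logb 2 (1 + (μ + b / n)) with hU
  have hUt : Tendsto U atTop (nhds (1 / 2 * Real.logb 2 (1 + μ))) := tendsto_upper hμ0
  have hUoff : ∀ n, ∀ g ∈ admissibleOffline A Bmax b n, throughput P E g ≤ U n := fun n g hg =>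
    throughput_le hA hE hident hb hbB hμ hμ0 hg
  have hUon : ∀ n, ∀ g ∈ admissibleOnline A Bmax b n, throughput P E g.toOffline ≤ U n :=
    fun n g hg => hUoff n _ (toOffline_mem hg)
  set q := μ / Bmax with hq
  have hq0 : 0 ≤ q := div_nonneg hμ0 hB
  have hq1 : q ≤ 1 := div_le_one_of_le₀ hμB hB
  have hmem := truncate_fractionPolicy_mem hA hq0 hq1 hb hB
  set T : ℕ → ℝ := fun n =>
    throughput P E (truncate (fractionPolicy A q Bmax b) n).toOffline with hT
  set S : ℕ → ℝ := fun n => sSup ((fun g : OnlinePolicy A n => throughput P E g.toOffline) ''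
    admissibleOnline A Bmax b n) with hS
  set R : ℕ → ℝ := fun n => sSup ((fun g : OfflinePolicy A n => throughput P E g) ''
    admissibleOffline A Bmax b n) with hR
  have hT0 : ∀ n, 0 ≤ T n := fun n => throughput_nonneg (hmem n).2
  have hTS : ∀ n, T n ≤ S n := fun n => le_csSup
    ⟨U n, by rintro _ ⟨g, hg, rfl⟩; exact hUon n g hg⟩ ⟨_, hmem n, rfl⟩
  have hSR : ∀ n, S n ≤ R n := fun n => by
    refine csSup_le ⟨_, _, hmem n, rfl⟩ ?_
    rintro _ ⟨g, hg, rfl⟩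
    exact le_csSup ⟨U n, by rintro _ ⟨g, hg, rfl⟩; exact hUoff n g hg⟩
      ⟨g.toOffline, toOffline_mem hg, rfl⟩
  have hRU : ∀ n, R n ≤ U n := fun n => by
    refine csSup_le ⟨_, _, toOffline_mem (hmem n), rfl⟩ ?_
    rintro _ ⟨g, hg, rfl⟩
    exact hUoff n g hg
  -- The bounds by `0` and by the convergent `U` keep the real-valued `liminf` from taking a junk
  -- value.
  have hmono : ∀ {v w : ℕ → ℝ}, (∀ n, 0 ≤ v n) → (∀ n, v n ≤ w n) → (∀ n, w n ≤ U n) →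
      liminf v atTop ≤ liminf w atTop := fun {v w} hv hvw hw =>
    liminf_le_liminf (Eventually.of_forall hvw) (isBoundedUnder_of ⟨0, hv⟩)
      (hUt.isBoundedUnder_le.mono_le (Eventually.of_forall hw)).isCoboundedUnder_ge
  have hlow : ∀ᶠ n in atTop, 1 / 2 * Real.logb 2 (1 + μ) - 1.80 ≤ T n := by
    -- If `μ = 0` the claimed bound is negative; this also disposes of `Bmax = 0`, where `q` is `0 /
    -- 0 = 0`.
    rcases hμ0.eq_or_lt with h0 | hpos
    · refine Eventually.of_forall fun n => le_trans ?_ (hT0 n)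
      rw [← h0]
      norm_num
    · have hBpos : 0 < Bmax := hpos.trans_le hμB
      have hqpos : 0 < q := div_pos hpos hBpos
      have hlim := tendsto_const_div_atTop_nhds_zero_nat (Real.log (1 + μ) / q)
      -- It is enough that the `1 / n` term falls below `1`: the total loss of `2` is less than
      -- `1.80 * (2 * log 2) ≈ 2.495`.
      filter_upwards [hlim.eventually (gt_mem_nhds one_pos), eventually_gt_atTop 0] with n h1 hn
      refine le_trans ?_ (throughput_fractionPolicy_ge (q := q) hA hE hindep hident hb hBpos hμ
        (div_mul_cancel₀ _ hBpos.ne') hqpos hq1 hn)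
      rw [half_logb, le_div_iff₀ two_log_two_pos, sub_mul, div_mul_cancel₀ _ two_log_two_pos.ne']
      have := Real.log_two_gt_d9
      linarith
  have hTlim : 1 / 2 * Real.logb 2 (1 + μ) - 1.80 ≤ liminf T atTop :=
    le_liminf_of_le (hUt.isBoundedUnder_le.mono_le (Eventually.of_forall fun n =>
      ((hTS n).trans (hSR n)).trans (hRU n))).isCoboundedUnder_ge hlow
  refine ⟨⟨hTlim.trans (hmono hT0 hTS fun n => (hSR n).trans (hRU n)),
    hmono (fun n => (hT0 n).trans (hTS n)) hSR hRU, ?_⟩, fractionPolicy A q Bmax b, hmem, hTlim⟩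
  exact (hmono (fun n => ((hT0 n).trans (hTS n)).trans (hSR n)) hRU fun _ => le_rfl).trans
    hUt.liminf_eq.le
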